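/- For a uniform space $X$, let $U_b(X)$ be the space of bounded uniformly continuous functions $f : X \to \mathbb{R}$ with the supremum norm, and let $M(X)$ be its norm dual. The weak$^*$ topology on $M(X)$ is the topology of pointwise convergence on $U_b(X)$. For a uniformly continuous pseudometric $d$ on $X$ put $$\mathrm{Lip}(d) = \{ f : X \to \mathbb{R} \;:\; |f(x)| \le 1 \text{ and } |f(x) - f(x')| \le d(x,x') \text{ for all } x, x' \in X \} \subseteq U_b(X),$$ with the topology of pointwise convergence on $X$. The space $M_u(X)$ of uniform measures on $X$ consists of those $\mu \in M(X)$ whose restriction to $\mathrm{Lip}(d)$ is continuous for every uniformly continuous pseudometric $d$ on $X$. For uniform spaces $X$ and $Y$, the semiuniform product $X * Y$ is the set $X \times Y$ with the uniformity characterized by the following property: a map $p$ from $X * Y$ to a uniform space $W$ is uniformly continuous if and only if the set $\{ p(\cdot, y) : y \in Y \}$ of maps from $X$ to $W$ is uniformly equicontinuous and, for each $x \in X$, the map $p(x, \cdot) : Y \to W$ is uniformly continuous. For $\mu \in M(X)$ and $\nu \in M(Y)$, the direct product $\mu \otimes \nu \in M(X * Y)$ is defined by $$(\mu \otimes \nu)(f)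 = \mu\bigl( x \mapsto \nu( y \mapsto f(x,y) ) \bigr) \qquad (f \in U_b(X * Y)).$$ **Corollary.** Let $X$ and $Y$ be uniform spaces. When $M_u(X)$, $M_u(Y)$ and $M(X * Y)$ are endowed with their weak$^*$ topologies, the mapping $(\mu, \nu) \mapsto \mu \otimes \nu$ from $M_u(X) \times M_u(Y)$ to $M(X * Y)$ is jointly sequentially continuous: if $\mu_n, \mu \in M_u(X)$ and $\nu_n, \nu \in M_u(Y)$ for $n = 1, 2, \dots$, with $\mu_n \to \mu$ and $\nu_n \to \nu$ in the weak$^*$ topologies, then $\mu_n \otimes \nu_n \to \mu \otimes \nu$ in the weak$^*$ topology. -/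

import Mathlib

open scoped Topology Uniformity
open scoped BoundedContinuousFunction

noncomputable section

namespace UniformMeasure

/-! ### Bounded uniformly continuous functions and their dual -/

/-- The bounded uniformly continuous real functions on the uniform space `X`, as a subspace of the
space of bounded continuous functions. -/
def ubSubmodule (X : Type*) [UniformSpace X] : Submodule ℝ (X →ᵇ ℝ) where
  carrier := {f | UniformContinuous f}
  add_mem' hf hg := UniformContinuous.add hf hg
  zero_mem' := uniformContinuous_const
  smul_mem' c _ hf := UniformContinuous.const_smul hf c

/-- `Ub X` is the space of bounded uniformly continuous real functions on the uniform space `X`,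
with the supremum norm (inherited from the space of bounded continuous functions). -/
def Ub (X : Type*) [UniformSpace X] : Type _ := ubSubmodule X

instance Ub.instNormedAddCommGroup (X : Type*) [UniformSpace X] : NormedAddCommGroup (Ub X) :=
  inferInstanceAs (NormedAddCommGroup (ubSubmodule X))

instance Ub.instNormedSpace (X : Type*) [UniformSpace X] : NormedSpace ℝ (Ub X) :=
  inferInstanceAs (NormedSpace ℝ (ubSubmodule X))

instance Ub.instCoeFun (X : Type*) [UniformSpace X] : CoeFun (Ub X) fun _ => X → ℝ := ⟨fun f => f.1⟩

lemma Ub.ext {X : Type*} [UniformSpace X] {f g : Ub X} (h : ∀ x, f x = g x) : f = g :=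
  Subtype.ext (BoundedContinuousFunction.ext h)

/-- Build an element of `Ub X` from a function with a uniform bound. -/
def Ub.mk {X : Type*} [UniformSpace X] (g : X → ℝ) (hg : UniformContinuous g) (C : ℝ)
    (hC : ∀ x, |g x| ≤ C) : Ub X :=
  ⟨BoundedContinuousFunction.ofNormedAddCommGroup g hg.continuous C hC, hg⟩

/-- `Meas X` is the space of norm-continuous linear functionals on `Ub X`.  As a topological space
it carries the weak-* topology, i.e. the topology of pointwise convergence on `Ub X`. -/
abbrev Meas (X : Type*) [UniformSpace X] : Type _ := WeakDual ℝ (Ub X)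

/-! ### Uniform measures -/

/-- A pseudometric `d` on a uniform space `X` is uniformly continuous
(as a function on `X × X` with the product uniformity). -/
def IsUCP {X : Type*} [UniformSpace X] (d : PseudoMetric X ℝ) : Prop :=
  UniformContinuous fun p : X × X => d p.1 p.2

/-- `Lip d` is the set of `f : X → ℝ` with `|f| ≤ 1` and `|f x - f x'| ≤ d x x'`.  As a subset of
`X → ℝ` it carries the topology of pointwise convergence. -/
def Lip {X : Type*} (d : PseudoMetric X ℝ) : Set (X → ℝ) :=
  {f | (∀ x, |f x| ≤ 1) ∧ ∀ x x', |f x - f x'| ≤ d x x'}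

lemma uniformContinuous_of_mem_Lip {X : Type*} [UniformSpace X] {d : PseudoMetric X ℝ}
    (hd : IsUCP d) {f : X → ℝ} (hf : f ∈ Lip d) : UniformContinuous f := by
  rw [UniformContinuous, Metric.uniformity_basis_dist.tendsto_right_iff]
  intro ε hε
  have hd' : Filter.Tendsto (fun p : (X × X) × X × X => (d p.1.1 p.1.2, d p.2.1 p.2.2))
      (𝓤 (X × X)) (𝓤 ℝ) := hd
  have hpair : Filter.Tendsto (fun p : X × X => (p, (p.2, p.2))) (𝓤 X) (𝓤 (X × X)) := by
    rw [uniformity_prod, Filter.tendsto_inf, Filter.tendsto_comap_iff, Filter.tendsto_comap_iff]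
    exact ⟨Filter.tendsto_id, tendsto_diag_uniformity (fun p : X × X => p.2) (𝓤 X)⟩
  filter_upwards [(hd'.comp hpair) (Metric.dist_mem_uniformity hε)] with p hp
  have h1 : |d p.1 p.2 - d p.2 p.2| < ε := hp
  rw [d.refl, sub_zero] at h1
  exact ((hf.2 p.1 p.2).trans (le_abs_self _)).trans_lt h1

/-- The inclusion of `Lip d` into `Ub X`, for a uniformly continuous pseudometric `d`. -/
def Lip.toUb {X : Type*} [UniformSpace X] {d : PseudoMetric X ℝ} (hd : IsUCP d) (f : Lip d) :
    Ub X :=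
  Ub.mk f.1 (uniformContinuous_of_mem_Lip hd f.2) 1 f.2.1

/-- `UMeas X` is the space of uniform measures on `X`: those `μ` whose restriction to `Lip d` is
continuous, in the topology of pointwise convergence on `X`, for every uniformly continuous
pseudometric `d` on `X`.  As a subtype of `Meas X`, it carries the weak-* topology. -/
def UMeas (X : Type*) [UniformSpace X] : Submodule ℝ (Meas X) where
  carrier := {μ | ∀ (d : PseudoMetric X ℝ) (hd : IsUCP d),
    Continuous fun f : Lip d => μ (Lip.toUb hd f)}
  add_mem' hμ hν d hd := (hμ d hd).add (hν d hd)
  zero_mem' _ _ := continuous_const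
  smul_mem' c _ hμ d hd := (hμ d hd).const_smul c

/-! ### The semiuniform product -/

/-- The underlying set of the semiuniform product of `X` and `Y` is `X × Y`. -/
def SemiProd (X Y : Type*) : Type _ := X × Y

/-- Conditions (SU1) and (SU2) on a map `p : X × Y → W` into a uniform space: the maps `p(·, y)`,
`y ∈ Y`, are uniformly equicontinuous, and each map `p(x, ·)` is uniformly continuous. -/
def IsSemiuniform {X Y W : Type*} [UniformSpace X] [UniformSpace Y] [UniformSpace W]
    (p : X × Y → W) : Prop :=
  UniformEquicontinuous (fun (y : Y) (x : X) => p (x, y)) ∧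
    ∀ x : X, UniformContinuous fun y : Y => p (x, y)

/-- The semiuniform product uniformity: the finest uniformity on `X × Y` for which the identity map
of `X × Y` satisfies (SU1) and (SU2).  (In the order on `UniformSpace`, finer means smaller.) -/
abbrev semiUniformity (X Y : Type*) [UniformSpace X] [UniformSpace Y] : UniformSpace (X × Y) :=
  sInf {u : UniformSpace (X × Y) | @IsSemiuniform X Y (X × Y) _ _ u id}

instance SemiProd.instUniformSpace (X Y : Type*) [UniformSpace X] [UniformSpace Y] :
    UniformSpace (SemiProd X Y) :=
  semiUniformity X Y

lemma isSemiuniform_id (X Y : Type*) [UniformSpace X] [UniformSpace Y] :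
    @IsSemiuniform X Y (X × Y) _ _ (semiUniformity X Y) id := by
  refine ⟨?_, fun x => ?_⟩
  · rw [semiUniformity, sInf_eq_iInf', uniformEquicontinuous_iInf_rng]
    exact fun u => u.2.1
  · rw [semiUniformity, uniformContinuous_sInf_rng]
    exact fun u hu => hu.2 x

/-- The characteristic property of the semiuniform product: a map from it to any uniform space is
uniformly continuous iff it satisfies (SU1) and (SU2). -/
theorem SemiProd.uniformContinuous_iff {X Y W : Type*} [UniformSpace X] [UniformSpace Y]
    [UniformSpace W] (p : SemiProd X Y → W) :
    UniformContinuous p ↔ IsSemiuniform (X := X) (Y := Y) p := by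
  constructor
  · intro hp
    exact ⟨fun U hU => (isSemiuniform_id X Y).1 _ (hp hU),
      fun x => hp.comp ((isSemiuniform_id X Y).2 x)⟩
  · rintro ⟨h₁, h₂⟩
    rw [uniformContinuous_iff_le_comap]
    change semiUniformity X Y ≤ UniformSpace.comap p _
    refine sInf_le (show @IsSemiuniform X Y (X × Y) _ _ (UniformSpace.comap p _) id from ?_)
    refine ⟨?_, fun x => uniformContinuous_comap' (h₂ x)⟩
    intro U hU
    obtain ⟨V, hV, hVU⟩ := Filter.mem_comap.1 hU
    exact (h₁ V hV).mono fun q hq y => hVU (hq y)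

/-! ### The direct product -/

section DirectProduct

variable {X Y : Type*} [UniformSpace X] [UniformSpace Y]

/-- The section `y ↦ f (x, y)` of a function `f` on the semiuniform product. -/
def slice (f : Ub (SemiProd X Y)) (x : X) : Ub Y :=
  Ub.mk (fun y => f (x, y)) (((SemiProd.uniformContinuous_iff _).1 f.2).2 x) ‖f‖
    fun y => f.1.norm_coe_le_norm (x, y)

lemma norm_slice_le (f : Ub (SemiProd X Y)) (x : X) : ‖slice f x‖ ≤ ‖f‖ :=
  BoundedContinuousFunction.norm_ofNormedAddCommGroup_le
    (((SemiProd.uniformContinuous_iff _).1 f.2).2 x).continuous (norm_nonneg f)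
    fun y => f.1.norm_coe_le_norm (x, y)

lemma abs_apply_slice_le (ν : Meas Y) (f : Ub (SemiProd X Y)) (x : X) :
    |ν (slice f x)| ≤ ‖WeakDual.toStrongDual ν‖ * ‖f‖ :=
  ((WeakDual.toStrongDual ν).le_opNorm (slice f x)).trans
    (mul_le_mul_of_nonneg_left (norm_slice_le f x) (norm_nonneg _))

lemma uniformContinuous_apply_slice (ν : Meas Y) (f : Ub (SemiProd X Y)) :
    UniformContinuous fun x : X => ν (slice f x) := by
  have hf := Metric.uniformEquicontinuous_iff_right.1 ((SemiProd.uniformContinuous_iff _).1 f.2).1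
  rw [UniformContinuous, Metric.uniformity_basis_dist.tendsto_right_iff]
  intro ε hε
  have hN : 0 < ‖WeakDual.toStrongDual ν‖ + 1 := by positivity
  filter_upwards [hf (ε / (‖WeakDual.toStrongDual ν‖ + 1)) (by positivity)] with p hp
  have h1 : ‖slice f p.1 - slice f p.2‖ ≤ ε / (‖WeakDual.toStrongDual ν‖ + 1) :=
    (BoundedContinuousFunction.norm_le (by positivity)).2 fun y => (hp y).le
  have h2 : |ν (slice f p.1) - ν (slice f p.2)| ≤
      ‖WeakDual.toStrongDual ν‖ * ‖slice f p.1 - slice f p.2‖ := by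
    rw [← map_sub]
    exact (WeakDual.toStrongDual ν).le_opNorm _
  change |ν (slice f p.1) - ν (slice f p.2)| < ε
  calc _ ≤ ‖WeakDual.toStrongDual ν‖ * (ε / (‖WeakDual.toStrongDual ν‖ + 1)) :=
        h2.trans (mul_le_mul_of_nonneg_left h1 (norm_nonneg _))
    _ < (‖WeakDual.toStrongDual ν‖ + 1) * (ε / (‖WeakDual.toStrongDual ν‖ + 1)) :=
        mul_lt_mul_of_pos_right (lt_add_one _) (by positivity)
    _ = ε := by field_simp

/-- The function `x ↦ ν (y ↦ f (x, y))`. -/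
def partialInt (ν : Meas Y) (f : Ub (SemiProd X Y)) : Ub X :=
  Ub.mk (fun x => ν (slice f x)) (uniformContinuous_apply_slice ν f)
    (‖WeakDual.toStrongDual ν‖ * ‖f‖) (abs_apply_slice_le ν f)

lemma norm_partialInt_le (ν : Meas Y) (f : Ub (SemiProd X Y)) :
    ‖partialInt ν f‖ ≤ ‖WeakDual.toStrongDual ν‖ * ‖f‖ :=
  BoundedContinuousFunction.norm_ofNormedAddCommGroup_le
    (uniformContinuous_apply_slice ν f).continuous (by positivity) (abs_apply_slice_le ν f)

/-- The direct product of `μ` and `ν`: the functional `f ↦ μ (x ↦ ν (y ↦ f (x, y)))` on the bounded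
uniformly continuous functions on the semiuniform product. -/
def directProd (μ : Meas X) (ν : Meas Y) : Meas (SemiProd X Y) :=
  StrongDual.toWeakDual <| LinearMap.mkContinuous
    { toFun := fun f => μ (partialInt ν f)
      map_add' := fun f g => by
        rw [← map_add]
        congr 1
        refine Ub.ext fun x => ?_
        exact map_add ν (slice f x) (slice g x)
      map_smul' := fun c f => by
        rw [RingHom.id_apply, ← map_smul]
        congr 1
        refine Ub.ext fun x => ?_
        exact map_smul ν c (slice f x) }
    (‖WeakDual.toStrongDual μ‖ * ‖WeakDual.toStrongDual ν‖) fun f => by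
      rw [mul_assoc]
      exact ((WeakDual.toStrongDual μ).le_opNorm (partialInt ν f)).trans
        (mul_le_mul_of_nonneg_left (norm_partialInt_le ν f) (norm_nonneg _))

end DirectProduct

end UniformMeasure

end

/-! Split `(μ_n ⊗ ν_n) f` as `μ_n (x ↦ (ν_n - ν)(f (x, ·)))` plus `μ_n` of the fixed function `x ↦ ν
(f (x, ·))`; the latter converges by hypothesis. By Banach–Steinhaus the integrands of the former,
divided by one constant, lie in a single `Lip d`, and they tend to 0 pointwise. It remains to see
that a convergent sequence of uniform measures tends to 0 along such integrands
(`tendsto_apply_of_tendsto`); subtracting the limit, one may take `μ_n` null.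

Let `D` be a multiple of `d`. Baire category on the compact space `Lip D` gives a point `f₀` near
which a tail of `μ_n` is uniformly small. `Lip D` is not a group, so this cannot be translated to 0;
lattice operations replace translation. For null `f_n ≥ 0`, a ramp `p` of `f_n` is eventually -1 at
each point, so `max f₀ p` and `min f₀ (-p)` both tend to `f₀`, and `μ_n` is small on half their
difference. The average over `m` ramps is within `2 / m` of `f_n`, whatever `f₀` is
(`abs_sub_sum_halfGap_le`). -/

namespace UniformMeasure

open Filter

/-! ### Lattice operations and truncation in `Lip d` -/

section Lattice

variable {X : Type*}

lemma Lip.sup_mem {d : PseudoMetric X ℝ} {f g : X → ℝ} (hf : f ∈ Lip d) (hg : g ∈ Lip d) :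
    (fun x => max (f x) (g x)) ∈ Lip d :=
  ⟨fun x => abs_max_le_max_abs_abs.trans (max_le (hf.1 x) (hg.1 x)), fun x y =>
    (abs_max_sub_max_le_max _ _ _ _).trans (max_le (hf.2 x y) (hg.2 x y))⟩

lemma Lip.neg_mem {d : PseudoMetric X ℝ} {f : X → ℝ} (hf : f ∈ Lip d) :
    (fun x => -f x) ∈ Lip d :=
  ⟨fun x => (abs_neg _).trans_le (hf.1 x), fun x y => by
    rw [← neg_sub', abs_neg]
    exact hf.2 x y⟩

lemma Lip.inf_mem {d : PseudoMetric X ℝ} {f g : X → ℝ} (hf : f ∈ Lip d) (hg : g ∈ Lip d) :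
    (fun x => min (f x) (g x)) ∈ Lip d :=
  ⟨fun x => abs_min_le_max_abs_abs.trans (max_le (hf.1 x) (hg.1 x)), fun x y =>
    (abs_min_sub_min_le_max _ _ _ _).trans (max_le (hf.2 x y) (hg.2 x y))⟩

lemma Lip.posPart_mem {d : PseudoMetric X ℝ} {f : X → ℝ} (hf : f ∈ Lip d) :
    (fun x => max (f x) 0) ∈ Lip d :=
  ⟨fun x => abs_max_le_max_abs_abs.trans (max_le (hf.1 x) (by simp)), fun x y =>
    (abs_max_sub_max_le_abs _ _ _).trans (hf.2 x y)⟩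

/-- The multiple of a pseudometric by a nonnegative constant. -/
def scalePseudoMetric (c : ℝ) (hc : 0 ≤ c) (d : PseudoMetric X ℝ) : PseudoMetric X ℝ where
  toFun x y := c * d x y
  refl' x := by simp
  symm' x y := by rw [d.symm]
  triangle' x y z := by
    rw [← mul_add]
    exact mul_le_mul_of_nonneg_left (d.triangle x y z) hc

lemma IsUCP.scale [UniformSpace X] {d : PseudoMetric X ℝ} (hd : IsUCP d) {c : ℝ} (hc : 0 ≤ c) :
    IsUCP (scalePseudoMetric c hc d) :=
  UniformContinuous.const_smul hd c

/-- The truncation to `[-1, 1]` of an affine function of an element of `Lip d`. -/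
lemma Lip.clamp_mem {d : PseudoMetric X ℝ} {f : X → ℝ} (hf : f ∈ Lip d) {c : ℝ} (hc : 0 ≤ c)
    (b : ℝ) :
    (fun x => max (-1) (min 1 (c * f x - b))) ∈ Lip (scalePseudoMetric c hc d) := by
  refine ⟨fun x => abs_le.2 ⟨le_max_left _ _, max_le (by norm_num) (min_le_left _ _)⟩,
    fun x y => ?_⟩
  have h1 : |(c * f x - b) - (c * f y - b)| ≤ c * d x y := by
    rw [sub_sub_sub_cancel_right, ← mul_sub, abs_mul, abs_of_nonneg hc]
    exact mul_le_mul_of_nonneg_left (hf.2 x y) hc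
  have h2 := abs_max_sub_max_le_max (-1) (min 1 (c * f x - b)) (-1) (min 1 (c * f y - b))
  have h3 := abs_min_sub_min_le_max 1 (c * f x - b) 1 (c * f y - b)
  have h4 : 0 ≤ c * d x y := mul_nonneg hc (d.nonneg x y)
  rw [sub_self, abs_zero] at h2 h3
  exact h2.trans (max_le h4 (h3.trans (max_le h4 h1)))

end Lattice

/-! ### Compactness of `Lip d` under pointwise convergence -/

section Compactness

variable {X : Type*}

lemma Lip.isCompact (d : PseudoMetric X ℝ) : IsCompact (Lip d) := by
  have hK : IsCompact (Set.univ.pi fun _ : X => Set.Icc (-1 : ℝ) 1) :=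
    isCompact_univ_pi fun _ => isCompact_Icc
  refine hK.of_isClosed_subset ?_ fun f hf x _ => abs_le.1 (hf.1 x)
  have h : Lip d = (⋂ x, {f : X → ℝ | |f x| ≤ 1}) ∩
      ⋂ x, ⋂ y, {f : X → ℝ | |f x - f y| ≤ d x y} := by
    ext f
    simp [Lip]
  rw [h]
  refine (isClosed_iInter fun x => ?_).inter
    (isClosed_iInter fun x => isClosed_iInter fun y => ?_)
  · exact isClosed_le (continuous_apply x).abs continuous_const
  · exact isClosed_le ((continuous_apply x).sub (continuous_apply y)).abs continuous_const

instance Lip.instCompactSpace (d : PseudoMetric X ℝ) : CompactSpace (Lip d) :=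
  isCompact_iff_compactSpace.1 (Lip.isCompact d)

lemma Lip.zero_mem (d : PseudoMetric X ℝ) : (fun _ => 0) ∈ Lip d :=
  ⟨fun _ => by simp, fun x y => by simpa using d.nonneg x y⟩

instance Lip.instNonempty (d : PseudoMetric X ℝ) : Nonempty (Lip d) :=
  ⟨⟨_, Lip.zero_mem d⟩⟩

lemma Lip.tendsto_nhds_iff {d : PseudoMetric X ℝ} {f : ℕ → Lip d} {g : Lip d} :
    Tendsto f atTop (𝓝 g) ↔ ∀ x, Tendsto (fun n => (f n).1 x) atTop (𝓝 (g.1 x)) := by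
  rw [tendsto_subtype_rng, tendsto_pi_nhds]

end Compactness

/-! ### Recovering a function from its level ramps -/

section Levels

/-- The truncated ramp that is `-1` for `m * t ≤ j + 1` and `1` for `m * t ≥ j + 2`. -/
noncomputable def ramp (m j : ℕ) (t : ℝ) : ℝ := max (-1) (min 1 (2 * m * t - (2 * j + 3)))

/-- Half the gap between `max a p` and `min a (-p)`. For `a ∈ [-1, 1]` it is `0` at `p = -1` and
`1` at `p = 1`, whatever the value of `a`. -/
noncomputable def halfGap (a p : ℝ) : ℝ := (max a p - min a (-p)) / 2

/-- Layer-cake: the `j`-th term is the length of `[0, t] ∩ [j, j + 1]`. -/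
lemma sum_clamp (m : ℕ) {t : ℝ} (ht : 0 ≤ t) :
    ∑ j ∈ Finset.range m, max 0 (min 1 (t - j)) = min t m := by
  induction m with
  | zero => simp [ht]
  | succ k ih =>
    rw [Finset.sum_range_succ, ih]
    push_cast
    rcases le_total t k with h | h
    · rw [min_eq_left h, min_eq_left (h.trans (by linarith : (k : ℝ) ≤ k + 1)), max_eq_left,
        add_zero]
      exact (min_le_right _ _).trans (by linarith)
    · rw [min_eq_right h, max_eq_right (le_min zero_le_one (by linarith))]
      rcases le_total 1 (t - k) with h' | h'
      · rw [min_eq_left h', min_eq_right (by linarith)]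
      · rw [min_eq_right h', min_eq_left (by linarith)]
        ring

/-- With `le_halfGap_ramp`, brackets the half gap between two clamps two levels apart, so that the
dependence on `a` disappears after summation. -/
lemma halfGap_ramp_le {m j : ℕ} {a t : ℝ} (ha : |a| ≤ 1) :
    halfGap a (ramp m j t) ≤ max 0 (min 1 (m * t - j)) := by
  obtain ⟨h1, h2⟩ := abs_le.1 ha
  rcases le_total (m * t) (j + 1) with h | h
  · have : ramp m j t = -1 := max_eq_left ((min_le_right _ _).trans (by linarith))
    rw [this, halfGap, max_eq_left h1, neg_neg, min_eq_left h2]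
    simp
  · rw [min_eq_left (by linarith), max_eq_right zero_le_one, halfGap]
    have h3 : ramp m j t ≤ 1 := max_le (by norm_num) (min_le_left _ _)
    have h4 : max a (ramp m j t) ≤ 1 := max_le h2 h3
    have h5 : -1 ≤ min a (-ramp m j t) := le_min h1 (by linarith)
    linarith

lemma le_halfGap_ramp {m j : ℕ} {a t : ℝ} (ha : |a| ≤ 1) :
    max 0 (min 1 (m * t - (j + 2))) ≤ halfGap a (ramp m j t) := by
  obtain ⟨h1, h2⟩ := abs_le.1 ha
  rcases le_total (m * t) (j + 2) with h | h
  · rw [max_eq_left ((min_le_right _ _).trans (by linarith)), halfGap]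
    have h4 := le_max_left a (ramp m j t)
    have h5 := min_le_left a (-ramp m j t)
    linarith
  · have : ramp m j t = 1 := by
      rw [ramp, min_eq_left (by linarith), max_eq_right (by norm_num)]
    rw [this, halfGap, max_eq_right h2, min_eq_right h1]
    exact max_le (by norm_num) ((min_le_left _ _).trans (by norm_num))

lemma abs_sub_sum_halfGap_le {m : ℕ} (hm : 0 < m) {t : ℝ} (ht : 0 ≤ t) (ht1 : t ≤ 1) {a : ℕ → ℝ}
    (ha : ∀ j, |a j| ≤ 1) :
    |t - (m : ℝ)⁻¹ * ∑ j ∈ Finset.range m, halfGap (a j) (ramp m j t)| ≤ 2 / m := by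
  have hm' : (0 : ℝ) < m := Nat.cast_pos.2 hm
  have hmt : m * t ≤ m := by nlinarith
  have hmt0 : 0 ≤ m * t := by positivity
  have hup := (Finset.sum_le_sum fun j (_ : j ∈ Finset.range m) =>
    halfGap_ramp_le (m := m) (j := j) (t := t) (ha j)).trans_eq (sum_clamp m hmt0)
  rw [min_eq_left hmt] at hup
  have hlow := Finset.sum_le_sum fun j (_ : j ∈ Finset.range m) =>
    le_halfGap_ramp (m := m) (j := j) (t := t) (ha j)
  -- The lower clamps are the upper ones shifted by two levels; dropping the first two of `m + 2`
  -- terms, each at most 1, loses at most 2.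
  have hsum := sum_clamp (m + 2) hmt0
  rw [min_eq_left (by push_cast; linarith), Finset.sum_range_succ', Finset.sum_range_succ'] at hsum
  have e : ∀ j : ℕ, ((j + 1 + 1 : ℕ) : ℝ) = j + 2 := fun j => by push_cast; ring
  simp only [e] at hsum
  have hc : ∀ s : ℝ, max 0 (min 1 s) ≤ 1 := fun s => max_le zero_le_one (min_le_left _ _)
  have h0 := hc (m * t - ((0 + 1 : ℕ) : ℝ))
  have h1 := hc (m * t - ((0 : ℕ) : ℝ))
  have key : |m * t - ∑ j ∈ Finset.range m, halfGap (a j) (ramp m j t)| ≤ 2 :=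
    abs_le.2 ⟨by linarith, by linarith⟩
  rw [le_div_iff₀ hm', ← abs_of_pos hm', ← abs_mul, abs_of_pos hm', sub_mul,
    mul_right_comm, inv_mul_cancel₀ hm'.ne', one_mul, mul_comm t]
  exact key

end Levels

/-! ### Convergent sequences of uniform measures on `Lip d` -/

section Sequences

variable {X : Type*} [UniformSpace X]

/-- Uniform limits preserve uniform continuity. Completeness is what Banach–Steinhaus needs. -/
instance Ub.instCompleteSpace : CompleteSpace (Ub X) := by
  have h : IsClosed (ubSubmodule X : Set (X →ᵇ ℝ)) := by
    refine isClosed_of_closure_subset fun f hf => ?_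
    obtain ⟨u, hu, hlim⟩ := mem_closure_iff_seq_limit.1 hf
    exact (BoundedContinuousFunction.tendsto_iff_tendstoUniformly.1 hlim).uniformContinuous
      (Frequently.of_forall hu)
  exact h.completeSpace_coe

lemma Meas.tendsto_iff {ι : Type*} {l : Filter ι} {μ : ι → Meas X} {μ' : Meas X} :
    Tendsto μ l (𝓝 μ') ↔ ∀ f, Tendsto (fun i => μ i f) l (𝓝 (μ' f)) :=
  tendsto_iff_forall_eval_tendsto_topDualPairing

lemma Meas.exists_norm_bound {μ : ℕ → Meas X} {μ' : Meas X} (h : Tendsto μ atTop (𝓝 μ')) :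
    ∃ C, ∀ n, ‖WeakDual.toStrongDual (μ n)‖ ≤ C := by
  refine banach_steinhaus fun f => ?_
  obtain ⟨C, hC⟩ := (Metric.isBounded_range_of_tendsto _ (Meas.tendsto_iff.1 h f)).exists_norm_le
  exact ⟨C, fun n => hC _ ⟨n, rfl⟩⟩

lemma Meas.abs_apply_le (μ : Meas X) {C : ℝ} (hC : ‖WeakDual.toStrongDual μ‖ ≤ C) {f : Ub X}
    {δ : ℝ} (hδ : 0 ≤ δ) (hf : ∀ x, |f x| ≤ δ) : |μ f| ≤ C * δ :=
  ((WeakDual.toStrongDual μ).le_opNorm f).trans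
    (mul_le_mul hC ((BoundedContinuousFunction.norm_le hδ).2 hf) (norm_nonneg _)
      ((norm_nonneg _).trans hC))

/-- Baire category: a weak-* null sequence of uniform measures is uniformly small near some point
of the compact space `Lip d`. -/
lemma exists_eventually_nhds_abs_le {μ : ℕ → Meas X} (hμ : ∀ n, μ n ∈ UMeas X)
    (h : Tendsto μ atTop (𝓝 0)) {d : PseudoMetric X ℝ} (hd : IsUCP d) {ε : ℝ} (hε : 0 < ε) :
    ∃ (f₀ : Lip d) (N : ℕ), ∀ᶠ g in 𝓝 f₀, ∀ n ≥ N, |μ n (Lip.toUb hd g)| ≤ ε := by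
  have hclosed : ∀ N : ℕ, IsClosed {g : Lip d | ∀ n ≥ N, |μ n (Lip.toUb hd g)| ≤ ε} := by
    intro N
    simp only [Set.ofPred_forall]
    exact isClosed_iInter fun n => isClosed_iInter fun _ =>
      isClosed_le (hμ n d hd).abs continuous_const
  have hcover : ⋃ N : ℕ, {g : Lip d | ∀ n ≥ N, |μ n (Lip.toUb hd g)| ≤ ε} = Set.univ := by
    refine Set.eq_univ_of_forall fun g => Set.mem_iUnion.2 ?_
    have h1 := (Meas.tendsto_iff.1 h (Lip.toUb hd g)).abs
    have h2 : |(0 : Meas X) (Lip.toUb hd g)| < ε := by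
      change |(0 : ℝ)| < ε
      simpa using hε
    exact eventually_atTop.1 ((h1.eventually_lt_const h2).mono fun n hn => hn.le)
  obtain ⟨N, f₀, hf₀⟩ := nonempty_interior_of_iUnion_of_closed hclosed hcover
  exact ⟨f₀, N, mem_interior_iff_mem_nhds.1 hf₀⟩

/-- A weak-* null sequence of uniform measures tends to `0` along pointwise null sequences of
nonnegative functions in `Lip d`. -/
lemma tendsto_apply_of_nonneg {μ : ℕ → Meas X} (hμ : ∀ n, μ n ∈ UMeas X)
    (h : Tendsto μ atTop (𝓝 0)) {d : PseudoMetric X ℝ} (hd : IsUCP d) {f : ℕ → Lip d}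
    (hf0 : ∀ n x, 0 ≤ (f n).1 x) (hf : ∀ x, Tendsto (fun n => (f n).1 x) atTop (𝓝 0)) :
    Tendsto (fun n => μ n (Lip.toUb hd (f n))) atTop (𝓝 0) := by
  obtain ⟨C, hC⟩ := Meas.exists_norm_bound h
  have hC0 : 0 ≤ C := (norm_nonneg _).trans (hC 0)
  rw [Metric.tendsto_atTop']
  intro ε hε
  -- Makes the approximation error `2 / m` cost at most `ε / 2` under every `μ n`.
  obtain ⟨m, hm⟩ := exists_nat_gt (C * 2 / (ε / 2))
  have hm0 : (0 : ℝ) < m := lt_of_le_of_lt (by positivity) hm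
  have hmC : C * (2 / m) < ε / 2 := by
    rw [div_lt_iff₀ (by positivity)] at hm
    rw [← mul_div_assoc, div_lt_iff₀ hm0]
    linarith
  -- `2 * m` is the slope of the ramps.
  have hc : (0 : ℝ) ≤ 2 * m := by positivity
  set D := scalePseudoMetric (2 * (m : ℝ)) hc d
  have hDu : IsUCP D := hd.scale hc
  obtain ⟨f₀, N, hf₀⟩ := exists_eventually_nhds_abs_le hμ h hDu (half_pos hε)
  have hp : ∀ j n, (fun x => ramp m j ((f n).1 x)) ∈ Lip D := fun j n =>
    Lip.clamp_mem (f n).2 hc _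
  let A : ℕ → ℕ → Lip D := fun j n => ⟨_, Lip.sup_mem f₀.2 (hp j n)⟩
  let B : ℕ → ℕ → Lip D := fun j n => ⟨_, Lip.inf_mem f₀.2 (Lip.neg_mem (hp j n))⟩
  -- Even the ramp `j = 0` only starts at height `1 / m > 0`, so a null sequence ends up where every
  -- ramp is exactly -1.
  have hramp : ∀ j x, ∀ᶠ n in atTop, ramp m j ((f n).1 x) = -1 := by
    intro j x
    filter_upwards [(hf x).eventually_lt_const (inv_pos.2 hm0)] with n hn
    have h1 : m * (f n).1 x ≤ 1 := by
      rw [← mul_inv_cancel₀ hm0.ne']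
      exact mul_le_mul_of_nonneg_left hn.le hm0.le
    have h2 : (0 : ℝ) ≤ j := Nat.cast_nonneg j
    exact max_eq_left ((min_le_right _ _).trans (by linarith))
  have hA : ∀ j, Tendsto (A j) atTop (𝓝 f₀) := fun j => Lip.tendsto_nhds_iff.2 fun x =>
    tendsto_const_nhds.congr' <| (hramp j x).mono fun n hn => by
      change f₀.1 x = max (f₀.1 x) (ramp m j ((f n).1 x))
      rw [hn, max_eq_left (abs_le.1 (f₀.2.1 x)).1]
  have hB : ∀ j, Tendsto (B j) atTop (𝓝 f₀) := fun j => Lip.tendsto_nhds_iff.2 fun x =>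
    tendsto_const_nhds.congr' <| (hramp j x).mono fun n hn => by
      change f₀.1 x = min (f₀.1 x) (-ramp m j ((f n).1 x))
      rw [hn, neg_neg, min_eq_left (abs_le.1 (f₀.2.1 x)).2]
  let G : ℕ → ℕ → Ub X := fun j n =>
    (2⁻¹ : ℝ) • (Lip.toUb hDu (A j n) - Lip.toUb hDu (B j n))
  have hG : ∀ j n x, G j n x = halfGap (f₀.1 x) (ramp m j ((f n).1 x)) := fun j n x => by
    rw [halfGap, div_eq_inv_mul]
    rfl
  have hGle : ∀ᶠ n in atTop, ∀ j ∈ Finset.range m, |μ n (G j n)| ≤ ε / 2 := by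
    rw [eventually_all_finset]
    intro j _
    filter_upwards [(hA j).eventually hf₀, (hB j).eventually hf₀, eventually_ge_atTop N]
      with n h1 h2 h3
    rw [map_smul, map_sub, smul_eq_mul, abs_mul, abs_of_pos (by norm_num : (0 : ℝ) < 2⁻¹)]
    have := (abs_sub _ _).trans (add_le_add (h1 n h3) (h2 n h3))
    linarith
  obtain ⟨M, hM⟩ := eventually_atTop.1 hGle
  refine ⟨M, fun n hn => ?_⟩
  rw [Real.dist_0_eq_abs]
  have hsum : |μ n ((m : ℝ)⁻¹ • ∑ j ∈ Finset.range m, G j n)| ≤ ε / 2 := by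
    rw [map_smul, map_sum, smul_eq_mul, abs_mul, abs_of_pos (inv_pos.2 hm0), inv_mul_le_iff₀ hm0]
    refine (Finset.abs_sum_le_sum_abs _ _).trans ((Finset.sum_le_sum (hM n hn.le)).trans_eq ?_)
    simp
  have heval : ∀ x, (∑ j ∈ Finset.range m, G j n) x = ∑ j ∈ Finset.range m, G j n x := fun x =>
    map_sum (((BoundedContinuousFunction.evalCLM ℝ x).comp (ubSubmodule X).subtypeL) : Ub X →L[ℝ] ℝ)
      _ _
  have hdiff := Meas.abs_apply_le (μ n) (hC n) (δ := 2 / m) (by positivity)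
    (f := Lip.toUb hd (f n) - (m : ℝ)⁻¹ • ∑ j ∈ Finset.range m, G j n) fun x => by
      change |(f n).1 x - (m : ℝ)⁻¹ * (∑ j ∈ Finset.range m, G j n) x| ≤ 2 / m
      rw [heval]
      simp only [hG]
      exact abs_sub_sum_halfGap_le (Nat.cast_pos.1 hm0) (hf0 n x)
        ((le_abs_self _).trans ((f n).2.1 x)) fun _ => f₀.2.1 x
  rw [map_sub] at hdiff
  have := abs_sub_abs_le_abs_sub (μ n (Lip.toUb hd (f n)))
    (μ n ((m : ℝ)⁻¹ • ∑ j ∈ Finset.range m, G j n))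
  linarith

/-- A weak-* null sequence of uniform measures tends to `0` along pointwise null sequences in
`Lip d`. -/
lemma tendsto_apply_of_tendsto_zero {μ : ℕ → Meas X} (hμ : ∀ n, μ n ∈ UMeas X)
    (h : Tendsto μ atTop (𝓝 0)) {d : PseudoMetric X ℝ} (hd : IsUCP d) {f : ℕ → Lip d}
    (hf : ∀ x, Tendsto (fun n => (f n).1 x) atTop (𝓝 0)) :
    Tendsto (fun n => μ n (Lip.toUb hd (f n))) atTop (𝓝 0) := by
  have hpos := tendsto_apply_of_nonneg hμ h hd (f := fun n => ⟨_, Lip.posPart_mem (f n).2⟩)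
    (fun n x => le_max_right _ _) fun x => by
      simpa using (hf x).max (tendsto_const_nhds (x := (0 : ℝ)))
  have hneg := tendsto_apply_of_nonneg hμ h hd
    (f := fun n => ⟨_, Lip.posPart_mem (Lip.neg_mem (f n).2)⟩)
    (fun n x => le_max_right _ _) fun x => by
      simpa using (hf x).neg.max (tendsto_const_nhds (x := (0 : ℝ)))
  have hsub := hpos.sub hneg
  rw [sub_zero] at hsub
  refine hsub.congr fun n => ?_
  rw [← map_sub]
  congr 1
  refine Ub.ext fun x => ?_
  change max ((f n).1 x) 0 - max (-(f n).1 x) 0 = (f n).1 x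
  exact posPart_sub_negPart _

/-- A weak-* convergent sequence of uniform measures converges along pointwise null sequences in
`Lip d`. -/
lemma tendsto_apply_of_tendsto {μ : ℕ → Meas X} {μ' : Meas X} (hμ : ∀ n, μ n ∈ UMeas X)
    (hμ' : μ' ∈ UMeas X) (h : Tendsto μ atTop (𝓝 μ')) {d : PseudoMetric X ℝ} (hd : IsUCP d)
    {f : ℕ → Lip d} (hf : ∀ x, Tendsto (fun n => (f n).1 x) atTop (𝓝 0)) :
    Tendsto (fun n => μ n (Lip.toUb hd (f n))) atTop (𝓝 0) := by
  have h0 : Tendsto (fun n => μ n - μ') atTop (𝓝 0) := by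
    refine Meas.tendsto_iff.2 fun g => ?_
    have := (Meas.tendsto_iff.1 h g).sub_const (μ' g)
    rwa [sub_self] at this
  have h1 := tendsto_apply_of_tendsto_zero (fun n => (UMeas X).sub_mem (hμ n) hμ') h0 hd hf
  let z : Lip d := ⟨_, Lip.zero_mem d⟩
  have h2 := ((hμ' d hd).tendsto z).comp (Lip.tendsto_nhds_iff.2 hf)
  have hz : Lip.toUb hd z = 0 := Ub.ext fun _ => rfl
  rw [hz, map_zero] at h2
  have h3 := h1.add h2
  rw [add_zero] at h3
  exact h3.congr fun n => sub_add_cancel (μ n (Lip.toUb hd (f n))) (μ' (Lip.toUb hd (f n)))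

end Sequences

/-! ### Joint sequential continuity of the direct product -/

section DirectProduct

variable {X Y : Type*} [UniformSpace X] [UniformSpace Y]

/-- The pseudometric `c * sup_y |f (x, y) - f (x', y)|` on the first factor. -/
noncomputable def slicePseudoMetric (f : Ub (SemiProd X Y)) (c : ℝ) (hc : 0 ≤ c) :
    PseudoMetric X ℝ where
  toFun x x' := c * ‖slice f x - slice f x'‖
  refl' x := by simp
  symm' x x' := by rw [norm_sub_rev]
  triangle' x y z := by
    rw [← mul_add]
    exact mul_le_mul_of_nonneg_left (norm_sub_le_norm_sub_add_norm_sub _ _ _) hc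

lemma uniformContinuous_slice (f : Ub (SemiProd X Y)) : UniformContinuous (slice f) := by
  have hf := Metric.uniformEquicontinuous_iff_right.1 ((SemiProd.uniformContinuous_iff _).1 f.2).1
  rw [UniformContinuous, Metric.uniformity_basis_dist_le.tendsto_right_iff]
  intro ε hε
  filter_upwards [hf ε hε] with p hp
  have h : ‖slice f p.1 - slice f p.2‖ ≤ ε :=
    (BoundedContinuousFunction.norm_le hε.le).2 fun y => (hp y).le
  rwa [← dist_eq_norm] at h

lemma isUCP_slicePseudoMetric (f : Ub (SemiProd X Y)) {c : ℝ} (hc : 0 ≤ c) :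
    IsUCP (slicePseudoMetric f c hc) := by
  have h := uniformContinuous_slice f
  exact (uniformContinuous_norm.comp
    ((h.comp uniformContinuous_fst).sub (h.comp uniformContinuous_snd))).const_smul c

theorem seqContinuous_directProd :
    SeqContinuous fun p : UMeas X × UMeas Y => directProd (p.1 : Meas X) (p.2 : Meas Y) := by
  intro p q hpq
  have hμ : Tendsto (fun n => ((p n).1 : Meas X)) atTop (𝓝 (q.1 : Meas X)) :=
    ((continuous_subtype_val.comp continuous_fst).tendsto q).comp hpq
  have hν : Tendsto (fun n => ((p n).2 : Meas Y)) atTop (𝓝 (q.2 : Meas Y)) :=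
    ((continuous_subtype_val.comp continuous_snd).tendsto q).comp hpq
  refine Meas.tendsto_iff.2 fun f => ?_
  obtain ⟨C, hC⟩ := Meas.exists_norm_bound (μ := fun n => ((p n).2 : Meas Y) - (q.2 : Meas Y)) (μ' := 0) (by
    refine Meas.tendsto_iff.2 fun g => ?_
    have := (Meas.tendsto_iff.1 hν g).sub_const ((q.2 : Meas Y) g)
    rwa [sub_self] at this)
  have hC0 : 0 ≤ C := (norm_nonneg _).trans (hC 0)
  -- `C * ‖f‖` bounds the integrands `(ν_n - ν)(f (x, ·))`; adding 1 makes the divisor positive.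
  set M : ℝ := C * ‖f‖ + 1
  have hM0 : 0 < M := by positivity
  have hc : 0 ≤ M⁻¹ * C := by positivity
  have hd := isUCP_slicePseudoMetric f hc
  let g : ℕ → Lip (slicePseudoMetric f (M⁻¹ * C) hc) := fun n =>
    ⟨fun x => M⁻¹ * (((p n).2 : Meas Y) - (q.2 : Meas Y)) (slice f x), fun x => by
      rw [abs_mul, abs_of_pos (inv_pos.2 hM0), inv_mul_le_iff₀ hM0, mul_one]
      have := Meas.abs_apply_le _ (hC n) (norm_nonneg f) (f := slice f x)
        fun y => f.1.norm_coe_le_norm (x, y)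
      linarith, fun x x' => by
      rw [← mul_sub, ← map_sub, abs_mul, abs_of_pos (inv_pos.2 hM0)]
      change _ ≤ M⁻¹ * C * _
      rw [mul_assoc]
      refine mul_le_mul_of_nonneg_left ?_ (inv_pos.2 hM0).le
      exact Meas.abs_apply_le _ (hC n) (norm_nonneg _)
        fun y => (slice f x - slice f x').1.norm_coe_le_norm y⟩
  have hg : ∀ x, Tendsto (fun n => (g n).1 x) atTop (𝓝 0) := fun x => by
    have := ((Meas.tendsto_iff.1 hν (slice f x)).sub_const ((q.2 : Meas Y) (slice f x))).const_mul
      M⁻¹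
    rwa [sub_self, mul_zero] at this
  have h1 := (tendsto_apply_of_tendsto (fun n => (p n).1.2) q.1.2 hμ hd hg).const_mul M
  have h2 := h1.add (Meas.tendsto_iff.1 hμ (partialInt (q.2 : Meas Y) f))
  rw [mul_zero, zero_add] at h2
  refine h2.congr fun n => ?_
  change _ = ((p n).1 : Meas X) (partialInt ((p n).2 : Meas Y) f)
  rw [← smul_eq_mul, ← map_smul, ← map_add]
  congr 1
  refine Ub.ext fun x => ?_
  change M * (M⁻¹ * (((p n).2 : Meas Y) (slice f x) - (q.2 : Meas Y) (slice f x))) +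
    (q.2 : Meas Y) (slice f x) = ((p n).2 : Meas Y) (slice f x)
  rw [mul_inv_cancel_left₀ hM0.ne', sub_add_cancel]

end DirectProduct

end UniformMeasure

theorem mainTheorem5 {X Y : Type*} [UniformSpace X] [UniformSpace Y] :
    SeqContinuous fun p : UniformMeasure.UMeas X × UniformMeasure.UMeas Y =>
      UniformMeasure.directProd (p.1 : UniformMeasure.Meas X) (p.2 : UniformMeasure.Meas Y) :=
  UniformMeasure.seqContinuous_directProd
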